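/- Let $S=\mathbb{Q}[x_1,\dots,x_{16}]$ with the standard grading, and let $G=C_{16}(1,4,8)$ be the circulant graph on the vertices $1,\dots,16$ in which two distinct vertices $i,j$ are adjacent if and only if $i-j\equiv \pm1,\ \pm4$ or $8 \pmod{16}$. Let $I(G)=(x_ix_j : \{i,j\}\in E(G))\subset S$ be its edge ideal. Call an ideal $I \subset S$ unmixed if all associated primes of $S/I$ have the same height. For a homogeneous polynomial $f\in S$ of degree $d>0$ and proper, homogeneous, saturated (with respect to $(x_1,\dots,x_{16})$), unmixed ideals $A\subset B$ of $S$, the ideal $C=fB+A$ is called a basic double G-link of degree $d$ of $B$ on $A$ if $S/A$ is Cohen--Macaulay and generically Gorenstein (that is, $(S/A)_P$ is Gorenstein for every minimal prime $P$ of $A$), $\operatorname{ht}(A)+1=\operatorname{ht}(B)$, and $A:f=A$. Then there are no form $f\in S$, homogeneous ideal $A\subset S$ and monomial ideal $B\subset S$ such that $I(G)=fB+A$ is a basic double G-link (of any degree). -/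

import Mathlib

open MvPolynomial

/-- A Noetherian local ring is Cohen--Macaulay if it has a regular sequence (automatically
contained in the maximal ideal) whose length is the Krull dimension of the ring. -/
def IsCohenMacaulayLocal (R : Type*) [CommRing R] [IsLocalRing R] : Prop :=
  IsNoetherianRing R ∧
    ∃ rs : List R, RingTheory.Sequence.IsRegular R rs ∧
      ((rs.length : ℕ∞) : WithBot ℕ∞) = ringKrullDim R

/-- A Noetherian ring is Cohen--Macaulay if all its localizations at prime ideals are. -/
def IsCohenMacaulay (R : Type*) [CommRing R] : Prop :=
  IsNoetherianRing R ∧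
    ∀ (p : Ideal R) [p.IsPrime], IsCohenMacaulayLocal (Localization.AtPrime p)

/-- A Noetherian local ring is Gorenstein if it has finite injective dimension as a module over
itself. -/
def IsGorensteinLocal (R : Type*) [CommRing R] [IsLocalRing R] : Prop :=
  IsNoetherianRing R ∧
    ∃ n : ℕ, CategoryTheory.HasInjectiveDimensionLE (ModuleCat.of R R) n

/-- A ring is generically Gorenstein if its localizations at all minimal primes are Gorenstein. -/
def IsGenericallyGorenstein (R : Type*) [CommRing R] : Prop :=
  ∀ (p : Ideal R) [p.IsPrime], p ∈ minimalPrimes R → IsGorensteinLocal (Localization.AtPrime p)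

/-- An ideal `I` of `R` is (height) unmixed if all associated primes of `R ⧸ I` have the same
height in `R`. -/
def IsHeightUnmixed {R : Type*} [CommRing R] (I : Ideal R) : Prop :=
  ∀ p ∈ associatedPrimes R (R ⧸ I), ∀ q ∈ associatedPrimes R (R ⧸ I), p.height = q.height

section PolynomialRing

variable {σ K : Type*} [Field K]

attribute [local instance] MvPolynomial.gradedAlgebra in
/-- Homogeneity with respect to the standard grading of the polynomial ring. -/
def IsHomogeneousIdeal (I : Ideal (MvPolynomial σ K)) : Prop :=
  I.IsHomogeneous (homogeneousSubmodule σ K)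

/-- `I` is saturated with respect to the irrelevant ideal `m` generated by the variables:
`I : m = I`, equivalently `I : m ^ ∞ = I`. -/
def IsSaturatedIdeal (I : Ideal (MvPolynomial σ K)) : Prop :=
  I.colon (Set.range (X : σ → MvPolynomial σ K)) = I

/-- A monomial ideal is an ideal generated by a set of monomials. -/
def IsMonomialIdeal (I : Ideal (MvPolynomial σ K)) : Prop :=
  ∃ s : Set (σ →₀ ℕ), I = Ideal.span ((fun m => monomial m (1 : K)) '' s)

/-- `C = f B + A` is a basic double G-link of degree `d` of `B` on `A`. -/
structure IsBasicDoubleGLink (d : ℕ) (f : MvPolynomial σ K) (B A C : Ideal (MvPolynomial σ K)) :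
    Prop where
  proper_A : A ≠ ⊤
  homogeneous_A : IsHomogeneousIdeal A
  saturated_A : IsSaturatedIdeal A
  unmixed_A : IsHeightUnmixed A
  proper_B : B ≠ ⊤
  homogeneous_B : IsHomogeneousIdeal B
  saturated_B : IsSaturatedIdeal B
  unmixed_B : IsHeightUnmixed B
  le : A ≤ B
  cohenMacaulay : IsCohenMacaulay (MvPolynomial σ K ⧸ A)
  genericallyGorenstein : IsGenericallyGorenstein (MvPolynomial σ K ⧸ A)
  height : A.height + 1 = B.height
  degree_pos : 0 < d
  homogeneous_f : f.IsHomogeneous d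
  colon : A.colon {f} = A
  eq : C = Ideal.span {f} * B + A

end PolynomialRing

/-- The edge ideal of a simple graph, generated by the products `x_i x_j` over all edges. -/
noncomputable def edgeIdeal {V : Type*} (K : Type*) [Field K] (G : SimpleGraph V) : Ideal (MvPolynomial V K) :=
  Ideal.span {p | ∃ i j : V, G.Adj i j ∧ p = X i * X j}

/-- The circulant graph `C_16(1,4,8)`. The vertices `1, …, 16`, read modulo `16`, are the elements
of `Fin 16`. -/
def circulantC16 : SimpleGraph (Fin 16) :=
  SimpleGraph.circulantGraph {1, 4, 8}

/-! Write I for the edge ideal, H_J for the Hilbert function of S/J, and suppose I = fB + A. Since I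
is generated by quadrics and cannot lie in A, degree-two parts force deg f = 1 and put a linear form
into B, hence a variable x_s, because B is monomial (`IsBasicDoubleGLink.exists_X_mem`). As A : f =
A, also B = I : f. So B depends only on the set T of variables occurring in f: a monomial lies
outside B exactly when its support stays independent after adding some k in T. That x_s lies in B
means that T consists of neighbours of s.

The quotient S/A has dimension at least 5 at the origin (`five_le_height`), so by Cohen-Macaulayness
it has depth at least 5 there. As f is a nonzerodivisor modulo A and A + (f) = I + (f), the ring
S/(I + (f)) has depth at least 4. Cutting by four regular linear forms, the fourth difference of its
Hilbert function becomes a Hilbert function, hence is nonnegative in degree 4.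

But H_{I+(f)}(i+1) = H_I(i+1) - H_B(i), and with H_I = 1, 16, 96, 320, 768 this difference is
H_{I+(f)}(0) + 4 - (H_B(3) - 4 H_B(2) + 6 H_B(1)). The bracket is at least 6 for every nonempty T
inside a neighbourhood, by rotation to s = 0 and a finite check (`faceCount_extendsIndep`), so the
difference is at most 5 - 6 < 0. -/

section Depth

open RingTheory.Sequence IsLocalRing CategoryTheory Abelian Limits Pointwise

universe u

/-- The module `M` over the local ring `R` has depth at least `t`. -/
def DepthGE (R M : Type*) [CommRing R] [IsLocalRing R] [AddCommGroup M] [Module R M] (t : ℕ) :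
    Prop :=
  ∃ rs : List R, t ≤ rs.length ∧ (∀ r ∈ rs, r ∈ maximalIdeal R) ∧ IsRegular M rs

/-! ### Depth over a Noetherian local ring -/

section LocalDepth

variable {R : Type u} [CommRing R] [IsLocalRing R] {M N : Type u} [AddCommGroup M] [Module R M]
  [AddCommGroup N] [Module R N]

lemma DepthGE.congr {t : ℕ} (e : M ≃ₗ[R] N) (h : DepthGE R M t) : DepthGE R N t := by
  obtain ⟨rs, h1, h2, h3⟩ := h
  exact ⟨rs, h1, h2, (e.isRegular_congr rs).1 h3⟩

/-- The given regular sequence need not start with `x`, so depth is measured by vanishing of Ext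
from the residue field k: Ext^i(k, M/xM) sits between Ext^i(k, M) and Ext^{i+1}(k, M), which both
vanish for i < t. -/
lemma DepthGE.quotSMulTop [IsNoetherianRing R] [Module.Finite R M] {t : ℕ}
    (h : DepthGE R M (t + 1)) {x : R} (hx : x ∈ maximalIdeal R) (hreg : IsSMulRegular M x) :
    DepthGE R (QuotSMulTop x M) t := by
  obtain ⟨rs, hlen, hmem, hrs⟩ := h
  have smul_lt : ∀ (M' : Type u) [AddCommGroup M'] [Module R M'] [Module.Finite R M']
      [Nontrivial M'], maximalIdeal R • (⊤ : Submodule R M') < ⊤ := by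
    intro M' _ _ _ _
    refine lt_top_iff_ne_top.2 (Ne.symm ?_)
    exact Submodule.top_ne_ideal_smul_of_le_jacobson_annihilator
      (maximalIdeal_le_jacobson _)
  have : Nontrivial M := hrs.nontrivial
  have : Nontrivial (QuotSMulTop x M) := nontrivial_quotSMulTop_of_mem_maximalIdeal M hx
  let k : ModuleCat.{u} R := ModuleCat.of R (R ⧸ maximalIdeal R)
  have hk : Module.support R k = PrimeSpectrum.zeroLocus (maximalIdeal R) := by
    rw [Module.support_eq_zeroLocus, Ideal.annihilator_quotient]
  have hext := ModuleCat.subsingleton_ext_of_exists_isRegular (maximalIdeal R) k hk.subset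
    (ModuleCat.of R M) (smul_lt M) rs hmem hrs
  obtain ⟨rs', h1, h2, h3⟩ := ModuleCat.exists_isRegular_of_exists_subsingleton_ext
    (maximalIdeal R) t (ModuleCat.of R (QuotSMulTop x M)) (smul_lt _) k hk (by
      intro i hi
      have zero1 := AddCommGrpCat.isZero_of_iff_subsingleton.mpr (hext i (by omega))
      have zero2 := AddCommGrpCat.isZero_of_iff_subsingleton.mpr (hext (i + 1) (by omega))
      exact AddCommGrpCat.subsingleton_of_isZero <| ShortComplex.Exact.isZero_of_both_zeros
        ((Ext.covariant_sequence_exact₃' k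
          (IsSMulRegular.smulShortComplex_shortExact (M := ModuleCat.of R M) hreg)) i (i + 1) rfl)
        (zero1.eq_zero_of_src _) (zero2.eq_zero_of_tgt _))
  exact ⟨rs', h1.ge, h2, h3⟩

end LocalDepth

/-! ### Depth of quotients of S localized at a prime of S/A -/

section Localization

variable {S : Type u} [CommRing S] {A : Ideal S} (p : Ideal (S ⧸ A)) [p.IsPrime]

/-- The canonical map from `S` to the localization of `S ⧸ A` at a prime ideal. -/
noncomputable abbrev quotLocMap : S →+* Localization.AtPrime p :=
  (algebraMap (S ⧸ A) (Localization.AtPrime p)).comp (Ideal.Quotient.mk A)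

variable {p}

lemma exists_quotLocMap_eq (r : Localization.AtPrime p) :
    ∃ s u : S, Ideal.Quotient.mk A u ∉ p ∧ r * quotLocMap p u = quotLocMap p s := by
  obtain ⟨⟨a, b⟩, h⟩ := IsLocalization.surj p.primeCompl r
  obtain ⟨s, rfl⟩ := Ideal.Quotient.mk_surjective a
  obtain ⟨b, hb⟩ := b
  obtain ⟨u, rfl⟩ := Ideal.Quotient.mk_surjective b
  exact ⟨s, u, hb, h⟩

lemma isUnit_quotLocMap {u : S} (hu : Ideal.Quotient.mk A u ∉ p) : IsUnit (quotLocMap p u) :=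
  IsLocalization.map_units (Localization.AtPrime p) (⟨_, hu⟩ : p.primeCompl)

lemma exists_mul_mem_of_quotLocMap_mem {J : Ideal S} (hAJ : A ≤ J) {s : S}
    (h : quotLocMap p s ∈ J.map (quotLocMap p)) :
    ∃ u, Ideal.Quotient.mk A u ∉ p ∧ u * s ∈ J := by
  rw [← Ideal.map_map, RingHom.comp_apply,
    IsLocalization.mem_map_algebraMap_iff p.primeCompl] at h
  obtain ⟨⟨⟨j, hj⟩, ⟨v, hv⟩⟩, h⟩ := h
  simp only at h
  rw [← map_mul, IsLocalization.eq_iff_exists p.primeCompl] at h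
  obtain ⟨⟨c, hc⟩, h⟩ := h
  obtain ⟨v, rfl⟩ := Ideal.Quotient.mk_surjective v
  obtain ⟨c, rfl⟩ := Ideal.Quotient.mk_surjective c
  refine ⟨c * v, ?_, ?_⟩
  · rw [map_mul]
    exact p.primeCompl.mul_mem hc hv
  · have h1 : Ideal.Quotient.mk A (c * v * s) ∈ J.map (Ideal.Quotient.mk A) := by
      have : Ideal.Quotient.mk A (c * v * s) = Ideal.Quotient.mk A c * j := by
        rw [← h]; simp only [map_mul]; ring
      rw [this]
      exact Ideal.mul_mem_left _ _ hj
    rw [← Ideal.mem_comap, Ideal.comap_map_of_surjective _ Ideal.Quotient.mk_surjective] at h1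
    rw [← RingHom.ker_eq_comap_bot, Ideal.mk_ker, sup_eq_left.2 hAJ] at h1
    exact h1

variable (p) in
/-- The localization at `p` of the quotient of `S` by `J` has depth at least `t`. -/
def QuotLocDepthGE (J : Ideal S) (t : ℕ) : Prop :=
  DepthGE (Localization.AtPrime p) (Localization.AtPrime p ⧸ J.map (quotLocMap p)) t

lemma QuotLocDepthGE.self {t : ℕ}
    (h : DepthGE (Localization.AtPrime p) (Localization.AtPrime p) t) : QuotLocDepthGE p A t := by
  have hA0 : A.map (quotLocMap p) = ⊥ := by
    rw [← Ideal.map_map, Ideal.map_quotient_self, Ideal.map_bot]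
  exact h.congr (Submodule.quotEquivOfEqBot _ hA0).symm

lemma QuotLocDepthGE.sup_span_singleton [IsNoetherianRing S] {J : Ideal S} (hAJ : A ≤ J) {t : ℕ}
    (h : QuotLocDepthGE p J (t + 1))
    {l : S} (hl : Ideal.Quotient.mk A l ∈ p) (hreg : ∀ g, l * g ∈ J → g ∈ J) :
    QuotLocDepthGE p (J ⊔ Ideal.span {l}) t := by
  have : IsNoetherianRing (Localization.AtPrime p) :=
    IsLocalization.isNoetherianRing p.primeCompl _ inferInstance
  have hx : quotLocMap p l ∈ maximalIdeal (Localization.AtPrime p) := by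
    rw [RingHom.comp_apply]
    exact (IsLocalization.AtPrime.to_map_mem_maximal_iff _ p _).2 hl
  have hr : IsSMulRegular (Localization.AtPrime p ⧸ J.map (quotLocMap p)) (quotLocMap p l) := by
    rw [isSMulRegular_quotient_iff_mem_of_smul_mem]
    intro r hrJ
    obtain ⟨s, u, hu, hsu⟩ := exists_quotLocMap_eq r
    have h1 : quotLocMap p (l * s) ∈ J.map (quotLocMap p) := by
      rw [map_mul, ← hsu, ← mul_assoc]
      exact Ideal.mul_mem_right _ _ hrJ
    obtain ⟨v, hv, h2⟩ := exists_mul_mem_of_quotLocMap_mem hAJ h1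
    have h3 : v * s ∈ J := hreg _ (by convert h2 using 1; ring)
    have h4 := Ideal.mem_map_of_mem (quotLocMap p) h3
    rw [map_mul, ← hsu] at h4
    exact (Ideal.mul_unit_mem_iff_mem _ (isUnit_quotLocMap hu)).1
      ((Ideal.unit_mul_mem_iff_mem _ (isUnit_quotLocMap hv)).1 h4)
  refine DepthGE.congr ?_ (DepthGE.quotSMulTop h hx hr)
  have e1 : (quotLocMap p l • ⊤ : Submodule (Localization.AtPrime p)
      (Localization.AtPrime p ⧸ J.map (quotLocMap p))) =
      Submodule.map (Submodule.mkQ (J.map (quotLocMap p))) (Ideal.span {quotLocMap p l}) := by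
    rw [← Submodule.ideal_span_singleton_smul, ← Submodule.range_mkQ (J.map (quotLocMap p)),
      ← Submodule.map_top, ← Submodule.map_smul'']
    simp
  refine (Submodule.quotEquivOfEq _ _ e1).trans
    ((Submodule.quotientQuotientEquivQuotientSup _ _).trans (Submodule.quotEquivOfEq _ _ ?_))
  rw [Ideal.map_sup, Ideal.map_span, Set.image_singleton]

/-- Positive depth excludes socle elements: if all of `p` killed the class of `g`, so would the
first member of a regular sequence, and `g` would vanish locally. -/
lemma QuotLocDepthGE.exists_mul_notMem [p.IsMaximal] {J : Ideal S} (hAJ : A ≤ J) {t : ℕ}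
    (h : QuotLocDepthGE p J (t + 1))
    {g : S} (hg : g ∉ J) : ∃ s, Ideal.Quotient.mk A s ∈ p ∧ s * g ∉ J := by
  by_contra! hs
  obtain ⟨rs, hlen, hmem, hrs⟩ := h
  match rs with
  | [] => simp at hlen
  | r :: rs =>
    have hr := ((isRegular_cons_iff _ _ _).1 hrs).1
    have hrm := hmem r (by simp)
    rw [isSMulRegular_quotient_iff_mem_of_smul_mem] at hr
    obtain ⟨s, u, hu, hsu⟩ := exists_quotLocMap_eq r
    have hsp : Ideal.Quotient.mk A s ∈ p := by
      rw [← IsLocalization.AtPrime.to_map_mem_maximal_iff (Localization.AtPrime p) p,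
        ← RingHom.comp_apply, ← hsu]
      exact Ideal.mul_mem_right _ _ hrm
    have h1 : quotLocMap p (s * g) ∈ J.map (quotLocMap p) :=
      Ideal.mem_map_of_mem _ (hs s hsp)
    have h2 : quotLocMap p g ∈ J.map (quotLocMap p) := by
      apply hr
      rw [map_mul, ← hsu, mul_right_comm] at h1
      exact (Ideal.mul_unit_mem_iff_mem _ (isUnit_quotLocMap hu)).1 h1
    obtain ⟨v, hv, h3⟩ := exists_mul_mem_of_quotLocMap_mem hAJ h2
    obtain ⟨w, hw⟩ := Ideal.Quotient.exists_inv (I := p)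
      (a := Ideal.Quotient.mk p (Ideal.Quotient.mk A v))
      (by rwa [Ne, Ideal.Quotient.eq_zero_iff_mem])
    obtain ⟨w, rfl⟩ := Ideal.Quotient.mk_surjective w
    obtain ⟨w, rfl⟩ := Ideal.Quotient.mk_surjective w
    -- `g` = (1 - vw)g + w(vg), where `w` inverts `v` modulo the maximal ideal `p`; both summands
    -- lie in `J`.
    have h4 : Ideal.Quotient.mk A (1 - v * w) ∈ p := by
      rw [← Ideal.Quotient.eq_zero_iff_mem, map_sub, map_sub, map_mul, map_mul, hw]
      simp
    have h5 := J.add_mem (hs _ h4) (J.mul_mem_left w h3)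
    apply hg
    convert h5 using 1
    ring

end Localization

end Depth

/-! ### Regular linear forms over an infinite field -/

section LinearForms

variable {σ K : Type*} [Field K]

/-- Linear prime avoidance: no associated prime of `J` contains all variables, so each meets the
space of linear forms in a proper subspace, and finitely many proper subspaces cannot cover it. -/
lemma exists_linear_form_regular [Infinite K] [Finite σ] {J : Ideal (MvPolynomial σ K)}
    (hJ : ∀ g ∉ J, ∃ i, X i * g ∉ J) :
    ∃ l : MvPolynomial σ K, l.IsHomogeneous 1 ∧ ∀ g, l * g ∈ J → g ∈ J := by
  let V (P : Ideal (MvPolynomial σ K)) : Subspace K (homogeneousSubmodule σ K 1) :=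
    (P.restrictScalars K).comap (homogeneousSubmodule σ K 1).subtype
  have hfin : (associatedPrimes (MvPolynomial σ K) (MvPolynomial σ K ⧸ J)).Finite :=
    associatedPrimes.finite _ _
  have := hfin.to_subtype
  have hcov : ⋃ P : associatedPrimes (MvPolynomial σ K) (MvPolynomial σ K ⧸ J),
      (V P : Set (homogeneousSubmodule σ K 1)) ≠ Set.univ := by
    intro h
    obtain ⟨⟨P, hP⟩, h⟩ := Subspace.exists_eq_top_of_iUnion_eq_univ h
    have hX : ∀ i, X i ∈ P := fun i => by
      have : (⟨X i, isHomogeneous_X K i⟩ : homogeneousSubmodule σ K 1) ∈ V P := by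
        rw [h]; trivial
      exact this
    obtain ⟨hPp, x, hx⟩ := isAssociatedPrime_iff_exists_injective_linearMap _ _ |>.1 hP
    obtain ⟨g, hg⟩ := Ideal.Quotient.mk_surjective (x (Ideal.Quotient.mk P 1))
    have hgJ : g ∉ J := by
      intro hgJ
      rw [Ideal.Quotient.eq_zero_iff_mem.2 hgJ] at hg
      have h0 := hx (hg.symm.trans (map_zero x).symm)
      rw [Ideal.Quotient.eq_zero_iff_mem] at h0
      exact hPp.ne_top ((Ideal.eq_top_iff_one _).2 h0)
    obtain ⟨i, hi⟩ := hJ g hgJ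
    apply hi
    rw [← Ideal.Quotient.eq_zero_iff_mem, map_mul, hg]
    change (X i : MvPolynomial σ K) • x (Ideal.Quotient.mk P 1) = 0
    rw [← map_smul]
    have : (X i : MvPolynomial σ K) • (Ideal.Quotient.mk P 1) = 0 := by
      change Ideal.Quotient.mk P (X i * 1) = 0
      rw [mul_one, Ideal.Quotient.eq_zero_iff_mem]
      exact hX i
    rw [this, map_zero]
  obtain ⟨⟨l, hl⟩, hlV⟩ := (Set.ne_univ_iff_exists_notMem _).1 hcov
  refine ⟨l, hl, fun g hg => ?_⟩
  by_contra hgJ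
  have hg0 : Ideal.Quotient.mk J g ≠ 0 := by rwa [Ne, Ideal.Quotient.eq_zero_iff_mem]
  obtain ⟨P, hP, hle⟩ := exists_le_isAssociatedPrime_of_isNoetherianRing (MvPolynomial σ K) _ hg0
  apply hlV
  refine Set.mem_iUnion.2 ⟨⟨P, hP⟩, hle ?_⟩
  rw [Submodule.mem_colon_singleton]
  change Ideal.Quotient.mk J (l * g) ∈ _
  rw [Ideal.Quotient.eq_zero_iff_mem.2 hg]
  exact Submodule.zero_mem _

end LinearForms

/-! ### Hilbert functions -/

section Hilbert

variable {σ K : Type*} [Field K]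

/-- The degree `i` part of an ideal `J`, as a subspace of the space of forms of degree `i`. -/
noncomputable abbrev gradedPiece (J : Ideal (MvPolynomial σ K)) (i : ℕ) :
    Submodule K (homogeneousSubmodule σ K i) :=
  (J.restrictScalars K).comap (homogeneousSubmodule σ K i).subtype

/-- The Hilbert function of the quotient by the ideal `J`. -/
noncomputable def hilbertFunction (J : Ideal (MvPolynomial σ K)) (i : ℕ) : ℕ :=
  Module.finrank K (homogeneousSubmodule σ K i ⧸ gradedPiece J i)

attribute [local instance] MvPolynomial.gradedAlgebra in
lemma IsHomogeneousIdeal.sup_span_singleton {J : Ideal (MvPolynomial σ K)}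
    (hJ : IsHomogeneousIdeal J) {l : MvPolynomial σ K} {d : ℕ} (hl : l.IsHomogeneous d) :
    IsHomogeneousIdeal (J ⊔ Ideal.span {l}) := by
  refine Ideal.IsHomogeneous.sup hJ (Ideal.homogeneous_span _ _ ?_)
  rintro x rfl
  exact ⟨d, hl⟩

lemma homogeneousComponent_mul_of_isHomogeneous {l : MvPolynomial σ K} {d : ℕ}
    (hl : l.IsHomogeneous d) (g : MvPolynomial σ K) (n : ℕ) :
    homogeneousComponent n (l * g) = if d ≤ n then l * homogeneousComponent (n - d) g else 0 := by
  classical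
  conv_lhs => rw [← sum_homogeneousComponent g, Finset.mul_sum, map_sum]
  have h : ∀ j, homogeneousComponent n (l * homogeneousComponent j g) =
      if n = d + j then l * homogeneousComponent j g else 0 := fun j => by
    rw [homogeneousComponent_of_mem (hl.mul (homogeneousComponent_isHomogeneous j g))]
  simp_rw [h]
  split_ifs with hd
  · obtain ⟨i, rfl⟩ := Nat.exists_eq_add_of_le hd
    simp only [Nat.add_left_cancel_iff, Nat.add_sub_cancel_left]
    rw [Finset.sum_ite_eq]
    split_ifs with hi
    · rfl
    · rw [homogeneousComponent_eq_zero, mul_zero]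
      simpa using hi
  · exact Finset.sum_eq_zero fun j _ => if_neg (by omega)

lemma homogeneousComponent_mem_ideal {J : Ideal (MvPolynomial σ K)}
    (hJ : IsHomogeneousIdeal J) {g : MvPolynomial σ K} (hg : g ∈ J) (i : ℕ) :
    homogeneousComponent i g ∈ J :=
  homogeneousComponent_mem_of_mem hJ hg i

instance [Finite σ] (i : ℕ) : Module.Finite K (homogeneousSubmodule σ K i) :=
  Module.Finite.iff_fg.2 (homogeneousSubmodule_fg σ K i)

/-- Rank-nullity for multiplication by `l` from degree i of S to degree i + 1 of S/J: the kernel is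
the colon ideal and the cokernel is the quotient by J + (l). -/
lemma hilbertFunction_sup_span_singleton [Finite σ] {J : Ideal (MvPolynomial σ K)}
    (hJ : IsHomogeneousIdeal J) {l : MvPolynomial σ K} (hl : l.IsHomogeneous 1) (i : ℕ) :
    hilbertFunction (J ⊔ Ideal.span {l}) (i + 1) + hilbertFunction (J.colon {l}) i =
      hilbertFunction J (i + 1) := by
  let μ : homogeneousSubmodule σ K i →ₗ[K] homogeneousSubmodule σ K (i + 1) :=
    (LinearMap.mulLeft K l).restrict (fun g hg => by
      have := hl.mul hg
      rw [add_comm] at this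
      exact this)
  let ν := (gradedPiece J (i + 1)).mkQ ∘ₗ μ
  have hker : LinearMap.ker ν = gradedPiece (J.colon {l}) i := by
    ext ⟨g, hg⟩
    simp only [ν, LinearMap.mem_ker, LinearMap.comp_apply, Submodule.mkQ_apply,
      Submodule.Quotient.mk_eq_zero]
    change l * g ∈ J ↔ g ∈ J.colon {l}
    rw [Submodule.mem_colon_singleton, smul_eq_mul, mul_comm]
  have hle : gradedPiece J (i + 1) ≤ gradedPiece (J ⊔ Ideal.span {l}) (i + 1) :=
    fun g hg => Ideal.mem_sup_left hg
  have hrange : LinearMap.range ν =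
      (gradedPiece (J ⊔ Ideal.span {l}) (i + 1)).map (gradedPiece J (i + 1)).mkQ := by
    apply le_antisymm
    · rintro _ ⟨g, rfl⟩
      refine ⟨μ g, ?_, rfl⟩
      change l * (g : MvPolynomial σ K) ∈ J ⊔ Ideal.span {l}
      exact Ideal.mem_sup_right (Ideal.mul_mem_right _ _ (Ideal.mem_span_singleton_self l))
    · rintro _ ⟨⟨g, hg⟩, hgJ, rfl⟩
      change g ∈ J ⊔ Ideal.span {l} at hgJ
      obtain ⟨a, ha, b, hb, hab⟩ := Submodule.mem_sup.1 hgJ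
      obtain ⟨c, rfl⟩ := Ideal.mem_span_singleton'.1 hb
      have hg' : g = homogeneousComponent (i + 1) a + l * homogeneousComponent i c := by
        have h1 := homogeneousComponent_mul_of_isHomogeneous hl c (i + 1)
        rw [if_pos (by omega), Nat.add_sub_cancel] at h1
        rw [← h1, ← map_add, mul_comm l c, hab]
        exact (homogeneousComponent_eq_self hg).symm
      refine ⟨⟨homogeneousComponent i c, homogeneousComponent_isHomogeneous i c⟩, ?_⟩
      simp only [ν, LinearMap.comp_apply, Submodule.mkQ_apply]
      rw [Eq.comm, Submodule.Quotient.eq]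
      change g - l * homogeneousComponent i c ∈ J
      rw [hg', add_sub_cancel_right]
      exact homogeneousComponent_mem_ideal hJ ha _
  have e1 := (Submodule.quotientQuotientEquivQuotient _ _ hle).finrank_eq
  have e2 := (Submodule.quotEquivOfEq _ _ hker).finrank_eq
  have e3 := ν.quotKerEquivRange.finrank_eq
  have e4 := Submodule.finrank_quotient_add_finrank (LinearMap.range ν)
  rw [hrange] at e3 e4
  unfold hilbertFunction
  omega

/-- The standard monomials, those violating `P`, form a basis of the quotient. -/
lemma hilbertFunction_eq_card [Finite σ] {J : Ideal (MvPolynomial σ K)} {P : (σ →₀ ℕ) → Prop}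
    (hJ : ∀ g, g ∈ J ↔ ∀ m ∈ g.support, P m) (i : ℕ) :
    hilbertFunction J i = Nat.card {m : σ →₀ ℕ // m.degree = i ∧ ¬ P m} := by
  classical
  have hfin : {m : σ →₀ ℕ | m.degree = i ∧ ¬ P m}.Finite :=
    (Finsupp.finite_of_degree_le i).subset fun m hm => hm.1.le
  have := hfin.fintype
  let ν : homogeneousSubmodule σ K i →ₗ[K] ({m : σ →₀ ℕ | m.degree = i ∧ ¬ P m} → K) :=
    LinearMap.pi fun m => lcoeff K m.1 ∘ₗ (homogeneousSubmodule σ K i).subtype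
  have hν : ∀ g m, ν g m = coeff m.1 g.1 := fun g m => rfl
  have hker : LinearMap.ker ν = gradedPiece J i := by
    ext ⟨g, hg⟩
    rw [LinearMap.mem_ker]
    change _ ↔ g ∈ J
    rw [hJ]
    constructor
    · intro h m hm
      by_contra hP
      have := congr_fun h ⟨m, hg.degree_eq_sum_deg_support hm |>.symm, hP⟩
      rw [hν] at this
      exact mem_support_iff.1 hm this
    · intro h
      ext ⟨m, hm⟩
      rw [hν]
      by_contra hc
      exact hm.2 (h m (mem_support_iff.2 hc))
  have hsurj : Function.Surjective ν := by
    intro φ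
    refine ⟨⟨∑ m, monomial m.1 (φ m), ?_⟩, ?_⟩
    · exact Submodule.sum_mem _ fun m _ => isHomogeneous_monomial _ m.2.1
    · ext m
      rw [hν]
      simp [coeff_sum, coeff_monomial, Subtype.val_inj]
  have e := (ν.quotKerEquivOfSurjective hsurj).finrank_eq
  rw [hker] at e
  unfold hilbertFunction
  rw [e, Module.finrank_fintype_fun_eq_card, ← Nat.card_eq_fintype_card]
  rfl

lemma hilbertFunction_antitone [Finite σ] {J J' : Ideal (MvPolynomial σ K)} (h : J ≤ J') (i : ℕ) :
    hilbertFunction J' i ≤ hilbertFunction J i := by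
  have hle : gradedPiece J i ≤ gradedPiece J' i := fun g hg => h hg
  exact LinearMap.finrank_le_finrank_of_surjective (Submodule.factor_surjective hle)

end Hilbert

/-! ### Counting monomials by their supports -/

section FaceCount

variable {α : Type*} [Fintype α]

open Classical in
/-- The number of sets with `j` elements that have the property `Q`. -/
noncomputable def faceCount (Q : Finset α → Prop) (j : ℕ) : ℕ :=
  ((Finset.univ.powersetCard j).filter Q).card

-- Dividing by the squarefree monomial on `F` leaves an arbitrary monomial in the variables of `F`,
-- counted by stars and bars. The empty support is separate, since its degree is 0.
open Classical in
lemma card_degree_support_eq (F : Finset α) (i : ℕ) :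
    Nat.card {m : α →₀ ℕ // m.degree = i + 1 ∧ m.support = F} =
      if F.card = 0 then 0 else i.choose (F.card - 1) := by
  have hdeg : ∀ m : α →₀ ℕ, m.degree = ∑ a, m a := fun m => Finsupp.degree_eq_sum m
  by_cases hF : F.card ≤ i + 1
  · let e : α →₀ ℕ := Finsupp.indicator F fun _ _ => 1
    have he : ∀ a, e a = if a ∈ F then 1 else 0 := fun a => by
      simp [e, Finsupp.indicator_apply]
    have hedeg : e.degree = F.card := by
      rw [hdeg]; simp [he]
    have hset : {m : α →₀ ℕ | m.degree = i + 1 ∧ m.support = F} =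
        (· + e) '' (Finset.finsuppAntidiag F (i + 1 - F.card) : Set (α →₀ ℕ)) := by
      ext m
      simp only [Set.mem_ofPred_eq, Set.mem_image, Finset.mem_coe, Finset.mem_finsuppAntidiag]
      constructor
      · rintro ⟨hm, hs⟩
        have hle : e ≤ m := by
          intro a
          rw [he]
          split_ifs with ha
          · rw [← hs] at ha
            exact Nat.one_le_iff_ne_zero.2 (Finsupp.mem_support_iff.1 ha)
          · exact Nat.zero_le _
        have hsup : (m - e).support ⊆ F := fun a ha => by
          rw [← hs]
          rw [Finsupp.mem_support_iff, Finsupp.tsub_apply] at ha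
          rw [Finsupp.mem_support_iff]
          omega
        refine ⟨m - e, ⟨?_, hsup⟩, tsub_add_cancel_of_le hle⟩
        have h1 : (m - e).degree + e.degree = i + 1 := by
          rw [← map_add, tsub_add_cancel_of_le hle, hm]
        have h2 : F.sum (m - e) = (m - e).degree :=
          (Finset.sum_subset hsup fun a _ ha => Finsupp.notMem_support_iff.1 ha).symm
        rw [h2]
        omega
      · rintro ⟨n, ⟨hn, hsup⟩, rfl⟩
        have h2 : F.sum n = n.degree :=
          (Finset.sum_subset hsup fun a _ ha => Finsupp.notMem_support_iff.1 ha).symm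
        refine ⟨by rw [map_add, hedeg, ← h2, hn]; omega, ?_⟩
        ext a
        rw [Finsupp.mem_support_iff, Finsupp.add_apply, he]
        split_ifs with ha
        · simp [ha]
        · have : n a = 0 := Finsupp.notMem_support_iff.1 fun h => ha (hsup h)
          simp [ha, this]
    have h1 : Nat.card {m : α →₀ ℕ // m.degree = i + 1 ∧ m.support = F} =
        {m : α →₀ ℕ | m.degree = i + 1 ∧ m.support = F}.ncard := rfl
    rw [h1, hset, Set.ncard_image_of_injective _ (add_left_injective e), Set.ncard_coe_finset,
      Finset.card_finsuppAntidiag_nat_eq_choose]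
    split_ifs with h0
    · rw [h0]
      simp
    · obtain ⟨k, hk⟩ := Nat.exists_eq_succ_of_ne_zero h0
      rw [hk] at hF ⊢
      rw [show k.succ + (i + 1 - k.succ) - 1 = i by omega, show i + 1 - k.succ = i - k by omega,
        Nat.choose_symm (by omega)]
      simp
  · have : IsEmpty {m : α →₀ ℕ // m.degree = i + 1 ∧ m.support = F} := by
      refine ⟨fun ⟨m, hm, hs⟩ => hF ?_⟩
      rw [← hm, ← hs, Finset.card_eq_sum_ones]
      exact Finset.sum_le_sum fun a ha => Nat.one_le_iff_ne_zero.2 (Finsupp.mem_support_iff.1 ha)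
    rw [Nat.card_of_isEmpty, Nat.choose_eq_zero_of_lt (by omega)]
    simp

open Classical in
lemma card_degree_support (Q : Finset α → Prop) (i : ℕ) :
    Nat.card {m : α →₀ ℕ // m.degree = i + 1 ∧ Q m.support} =
      ∑ j ∈ Finset.range (i + 1), faceCount Q (j + 1) * i.choose j := by
  have hfin : {m : α →₀ ℕ | m.degree = i + 1}.Finite := Finsupp.finite_of_degree_eq _
  let D := hfin.toFinset
  have hD : ∀ m, m ∈ D ↔ m.degree = i + 1 := fun m => by simp [D]
  have hcard : ∀ P : (α →₀ ℕ) → Prop,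
      Nat.card {m : α →₀ ℕ // m.degree = i + 1 ∧ P m} = (D.filter P).card := fun P => by
    rw [← Set.ncard_coe_finset]
    change Set.ncard _ = _
    congr 1
    ext m
    rw [Finset.mem_coe, Finset.mem_filter, hD]
    rfl
  have h1 : (D.filter fun m => Q m.support).card =
      ∑ F ∈ Finset.univ.filter Q, (D.filter fun m => m.support = F).card := by
    rw [Finset.card_eq_sum_card_fiberwise (f := Finsupp.support)
      (t := Finset.univ.filter Q) (fun m hm => by
        simpa using (Finset.mem_filter.1 hm).2)]
    refine Finset.sum_congr rfl fun F hF => ?_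
    congr 1
    ext m
    simp only [Finset.mem_filter, Finset.mem_univ, true_and] at hF ⊢
    constructor
    · tauto
    · rintro ⟨h, rfl⟩
      exact ⟨⟨h, hF⟩, rfl⟩
  have h3 : ∀ F : Finset α, (D.filter fun m => m.support = F).card =
      if F.card = 0 then 0 else i.choose (F.card - 1) := fun F => by
    rw [← card_degree_support_eq F i, hcard]
    congr
  rw [hcard, h1, Finset.sum_congr rfl fun F _ => h3 F]
  have h2 : ∀ F : Finset α, (if F.card = 0 then 0 else i.choose (F.card - 1)) =
      ∑ j ∈ Finset.range (i + 1), if F.card = j + 1 then i.choose j else 0 := by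
    intro F
    rcases Nat.eq_zero_or_eq_succ_pred F.card with h | h
    · simp [h]
    · rw [h, if_neg (Nat.succ_ne_zero _)]
      simp only [Nat.succ_eq_add_one, Nat.add_right_cancel_iff, Finset.sum_ite_eq,
        Finset.mem_range, Nat.add_sub_cancel]
      split_ifs with h4
      · rfl
      · exact Nat.choose_eq_zero_of_lt (by omega)
  simp_rw [h2]
  rw [Finset.sum_comm]
  refine Finset.sum_congr rfl fun j _ => ?_
  rw [← Finset.sum_filter, Finset.sum_const, smul_eq_mul]
  congr 2
  ext F
  simp [and_comm]

/-- Turns a face count into a Boolean count over explicit lists, which the kernel can evaluate. -/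
lemma faceCount_fin {n : ℕ} {Q : Finset (Fin n) → Prop} {q : List (Fin n) → Bool}
    (hq : ∀ l, q l = true ↔ Q l.toFinset) (j : ℕ) :
    faceCount Q j = ((List.finRange n).sublistsLen j).countP q := by
  classical
  unfold faceCount
  have h2 : (Finset.univ.powersetCard j : Finset (Finset (Fin n))).val.map Finset.val =
      (((List.finRange n).sublistsLen j).map Multiset.ofList : List (Multiset (Fin n))) := by
    rw [Finset.map_val_val_powersetCard, ← Multiset.powersetCard_coe]
    rfl
  have h3 : ((Finset.univ.powersetCard j).filter Q).card =
      ((Finset.univ.powersetCard j : Finset (Finset (Fin n))).val.map Finset.val).countP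
        (fun s => Q s.toFinset) := by
    rw [Multiset.countP_map, Finset.card_def, Finset.filter_val]
    simp
  rw [h3, h2, Multiset.coe_countP, List.countP_map]
  refine List.countP_congr fun l _ => ?_
  simp only [Function.comp_apply, decide_eq_true_eq]
  rw [hq]
  rfl

lemma faceCount_map_equiv (e : α ≃ α) (Q : Finset α → Prop) (j : ℕ) :
    faceCount (fun F => Q (F.map e.toEmbedding)) j = faceCount Q j := by
  classical
  unfold faceCount
  refine Finset.card_bij (fun F _ => F.map e.toEmbedding) ?_ ?_ ?_
  · intro F hF
    simpa using hF
  · intro F _ F' _ h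
    exact Finset.map_injective _ h
  · intro F hF
    refine ⟨F.map e.symm.toEmbedding, ?_, ?_⟩
    · simpa [Finset.map_map] using hF
    · ext; simp

end FaceCount

/-! ### Independent sets of the circulant graph -/

/-- The adjacency relation of the circulant graph `C_16(1,4,8)`, in computable form. -/
def circulantAdj (a b : Fin 16) : Bool :=
  [1, 4, 8, 12, 15].contains ((16 + a.val - b.val) % 16)

lemma circulantC16_adj (a b : Fin 16) : circulantC16.Adj a b ↔ circulantAdj a b = true := by
  unfold circulantC16
  rw [SimpleGraph.circulantGraph_adj]
  simp only [Set.mem_insert_iff, Set.mem_singleton_iff]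
  revert a b
  decide +kernel

/-- A list of vertices of `C_16(1,4,8)` is independent. -/
def circulantIndep (l : List (Fin 16)) : Bool := l.all fun a => l.all fun b => !circulantAdj a b

/-- A set of vertices of `C_16(1,4,8)` is independent. -/
def IsCirculantIndep (F : Finset (Fin 16)) : Prop :=
  ∀ a ∈ F, ∀ b ∈ F, ¬ circulantC16.Adj a b

lemma circulantIndep_iff (l : List (Fin 16)) :
    circulantIndep l = true ↔ IsCirculantIndep l.toFinset := by
  simp [circulantIndep, IsCirculantIndep, circulantC16_adj]

/-- A set of vertices of `C_16(1,4,8)` together with some vertex in `T` is independent. -/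
def ExtendsIndep (T F : Finset (Fin 16)) : Prop := ∃ k ∈ T, IsCirculantIndep (insert k F)

/-- The test for `ExtendsIndep` on lists. -/
def extendsIndep (T l : List (Fin 16)) : Bool :=
  circulantIndep l && T.any fun k => l.all fun a => !circulantAdj k a

lemma extendsIndep_iff (T l : List (Fin 16)) :
    extendsIndep T l = true ↔ ExtendsIndep T.toFinset l.toFinset := by
  have hirr : ∀ k, ¬ circulantC16.Adj k k := fun k => circulantC16.irrefl
  simp only [extendsIndep, Bool.and_eq_true, circulantIndep_iff, List.any_eq_true,
    List.all_eq_true, Bool.not_eq_true', ← Bool.not_eq_true, ← circulantC16_adj,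
    ExtendsIndep, IsCirculantIndep, List.mem_toFinset, Finset.mem_insert, forall_eq_or_imp]
  constructor
  · rintro ⟨h1, k, hk, h2⟩
    exact ⟨k, hk, ⟨hirr k, h2⟩, fun a ha => ⟨fun h => h2 a ha h.symm, h1 a ha⟩⟩
  · rintro ⟨k, hk, ⟨-, h2⟩, h3⟩
    exact ⟨fun a ha => (h3 a ha).2, k, hk, h2⟩

lemma faceCount_circulant :
    faceCount IsCirculantIndep 1 = 16 ∧ faceCount IsCirculantIndep 2 = 80 ∧
      faceCount IsCirculantIndep 3 = 144 ∧ faceCount IsCirculantIndep 4 = 80 := by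
  simp only [faceCount_fin circulantIndep_iff]
  decide +kernel

/-- The decisive finite computation: all 31 nonempty subsets of the neighbourhood {1, 4, 8, 12, 15}
of 0 are tested. -/
lemma faceCount_extendsIndep_zero {T : Finset (Fin 16)} (hT : T.Nonempty)
    (hT0 : ∀ k ∈ T, circulantC16.Adj 0 k) :
    2 * faceCount (ExtendsIndep T) 2 + 6 ≤
      faceCount (ExtendsIndep T) 3 + 3 * faceCount (ExtendsIndep T) 1 := by
  have key : ∀ L ∈ [1, 4, 8, 12, 15].sublists, L ≠ [] →
      2 * ((List.finRange 16).sublistsLen 2).countP (extendsIndep L) + 6 ≤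
        ((List.finRange 16).sublistsLen 3).countP (extendsIndep L) +
          3 * ((List.finRange 16).sublistsLen 1).countP (extendsIndep L) := by
    decide +kernel
  have hmem : ∀ k, circulantAdj 0 k = true → k ∈ [1, 4, 8, 12, 15] := by decide +kernel
  have hL : ([1, 4, 8, 12, 15].filter (· ∈ T)).toFinset = T := by
    ext k
    rw [List.mem_toFinset, List.mem_filter, decide_eq_true_eq]
    exact ⟨fun h => h.2, fun h => ⟨hmem k ((circulantC16_adj 0 k).1 (hT0 k h)), h⟩⟩
  have := key ([1, 4, 8, 12, 15].filter (· ∈ T)) (List.mem_sublists.2 List.filter_sublist)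
    (fun h => by rw [h] at hL; simp [← hL] at hT)
  rw [← hL]
  simpa only [faceCount_fin (extendsIndep_iff _)] using this

lemma circulantC16_adj_add (a b s : Fin 16) :
    circulantC16.Adj (a + s) (b + s) ↔ circulantC16.Adj a b :=
  SimpleGraph.circulantGraph_adj_translate

lemma faceCount_extendsIndep {T : Finset (Fin 16)} (hT : T.Nonempty) {s : Fin 16}
    (hTs : ∀ k ∈ T, circulantC16.Adj s k) :
    2 * faceCount (ExtendsIndep T) 2 + 6 ≤
      faceCount (ExtendsIndep T) 3 + 3 * faceCount (ExtendsIndep T) 1 := by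
  let e : Fin 16 ≃ Fin 16 := Equiv.addRight s
  have he : ∀ F : Finset (Fin 16),
      ExtendsIndep T (F.map e.toEmbedding) ↔ ExtendsIndep (T.map e.symm.toEmbedding) F := by
    intro F
    have hind : ∀ F : Finset (Fin 16), IsCirculantIndep (F.map e.toEmbedding) ↔
        IsCirculantIndep F := by
      intro F
      simp only [IsCirculantIndep, Finset.forall_mem_map]
      exact forall₂_congr fun a _ => forall₂_congr fun b _ =>
        not_congr (circulantC16_adj_add a b s)
    constructor
    · rintro ⟨k, hk, h⟩
      refine ⟨e.symm k, Finset.mem_map_of_mem _ hk, (hind _).1 ?_⟩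
      rw [Finset.map_insert]
      simpa using h
    · rintro ⟨k, hk, h⟩
      obtain ⟨k, hk', rfl⟩ := Finset.mem_map.1 hk
      refine ⟨k, hk', ?_⟩
      have := (hind _).2 h
      rw [Finset.map_insert] at this
      simpa using this
  have h1 : ∀ j, faceCount (ExtendsIndep T) j =
      faceCount (ExtendsIndep (T.map e.symm.toEmbedding)) j := fun j => by
    rw [← faceCount_map_equiv e (ExtendsIndep T)]
    simp_rw [he]
  simp_rw [h1]
  refine faceCount_extendsIndep_zero (hT.map) ?_
  intro k hk
  obtain ⟨k, hk', rfl⟩ := Finset.mem_map.1 hk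
  rw [← circulantC16_adj_add _ _ s]
  simpa [e] using hTs k hk'

/-! ### Membership in the edge ideal and in its colon by a linear form -/

section MonomialIdeals

variable {σ K : Type*} [Field K]

lemma mem_edgeIdeal_iff {G : SimpleGraph σ} {g : MvPolynomial σ K} :
    g ∈ edgeIdeal K G ↔
      ∀ m ∈ g.support, ∃ a ∈ m.support, ∃ b ∈ m.support, G.Adj a b := by
  have h : edgeIdeal K G = Ideal.span ((fun m => monomial m (1 : K)) ''
      {m | ∃ a b, G.Adj a b ∧ m = Finsupp.single a 1 + Finsupp.single b 1}) := by
    unfold edgeIdeal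
    congr 1
    ext p
    constructor
    · rintro ⟨a, b, hab, rfl⟩
      exact ⟨_, ⟨a, b, hab, rfl⟩, by simp [X, monomial_mul]⟩
    · rintro ⟨_, ⟨a, b, hab, rfl⟩, rfl⟩
      exact ⟨a, b, hab, by simp [X, monomial_mul]⟩
  rw [h, mem_ideal_span_monomial_image]
  refine forall₂_congr fun m _ => ?_
  constructor
  · rintro ⟨_, ⟨a, b, hab, rfl⟩, hle⟩
    refine ⟨a, ?_, b, ?_, hab⟩
    · have := hle a
      rw [Finsupp.add_apply, Finsupp.single_eq_same] at this
      exact Finsupp.mem_support_iff.2 (by omega)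
    · have := hle b
      rw [Finsupp.add_apply, Finsupp.single_eq_same] at this
      exact Finsupp.mem_support_iff.2 (by omega)
  · rintro ⟨a, ha, b, hb, hab⟩
    refine ⟨_, ⟨a, b, hab, rfl⟩, fun c => ?_⟩
    classical
    have hne := hab.ne
    rw [Finsupp.mem_support_iff] at ha hb
    rw [Finsupp.add_apply, Finsupp.single_apply, Finsupp.single_apply]
    split_ifs with h1 h2 h2
    · exact absurd (h1.trans h2.symm) hne
    · subst h1; omega
    · subst h2; omega
    · omega

lemma IsMonomialIdeal.monomial_mem {B : Ideal (MvPolynomial σ K)} (hB : IsMonomialIdeal B)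
    {g : MvPolynomial σ K} (hg : g ∈ B) {m : σ →₀ ℕ} (hm : m ∈ g.support) (c : K) :
    monomial m c ∈ B := by
  obtain ⟨s, rfl⟩ := hB
  rw [mem_ideal_span_monomial_image] at hg ⊢
  intro n hn
  rw [Finset.mem_singleton.1 (support_monomial_subset hn)]
  exact hg m hm

/-- If a linear form `f` multiplies the monomial ideal `B` exactly into an edge ideal, then `B`
consists of the monomials which become nonfaces upon multiplication by any variable of `f`. -/
lemma mem_iff_of_colon_edgeIdeal [DecidableEq σ] {G : SimpleGraph σ} {f : MvPolynomial σ K}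
    (hf : f.IsHomogeneous 1)
    {B : Ideal (MvPolynomial σ K)} (hB : IsMonomialIdeal B)
    (hfB : ∀ g, g ∈ B ↔ f * g ∈ edgeIdeal K G) (g : MvPolynomial σ K) :
    g ∈ B ↔ ∀ m ∈ g.support, ∀ k, coeff (Finsupp.single k 1) f ≠ 0 →
      ∃ a ∈ insert k m.support, ∃ b ∈ insert k m.support, G.Adj a b := by
  have hsupp : ∀ (m : σ →₀ ℕ) (k : σ),
      (m + Finsupp.single k 1).support = insert k m.support := by
    intro m k
    ext a
    simp only [Finsupp.mem_support_iff, Finsupp.add_apply, Finset.mem_insert,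
      Finsupp.single_apply]
    split_ifs with h
    · simp [h]
    · simp [Ne.symm h]
  constructor
  · intro hg m hm k hk
    have h1 := (hfB _).1 (hB.monomial_mem hg hm 1)
    rw [mem_edgeIdeal_iff] at h1
    have h2 := h1 (m + Finsupp.single k 1) (by
      rw [mem_support_iff, add_comm, coeff_mul_monomial, mul_one]
      exact hk)
    rwa [hsupp] at h2
  · intro h
    rw [← support_sum_monomial_coeff g]
    refine Ideal.sum_mem _ fun m hm => ?_
    rw [hfB, mem_edgeIdeal_iff]
    intro n hn
    obtain ⟨u, hu, v, hv, rfl⟩ := Finset.mem_add.1 (support_mul _ _ hn)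
    rw [Finset.mem_singleton.1 (support_monomial_subset hv)]
    have hu1 := hf.degree_eq_sum_deg_support hu
    obtain ⟨k, rfl⟩ : u ∈ Set.range fun i => Finsupp.single i 1 := by
      rw [Finsupp.range_single_one]; exact hu1.symm
    rw [add_comm, hsupp]
    exact h m hm k (mem_support_iff.1 hu)

lemma natCard_degree_zero {Q : (σ →₀ ℕ) → Prop} (hQ : Q 0) :
    Nat.card {m : σ →₀ ℕ // m.degree = 0 ∧ Q m} = 1 := by
  rw [Nat.card_eq_one_iff_unique]
  refine ⟨⟨fun a b => Subtype.ext ?_⟩, ⟨⟨0, by simp, hQ⟩⟩⟩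
  rw [(Finsupp.degree_eq_zero_iff _).1 a.2.1, (Finsupp.degree_eq_zero_iff _).1 b.2.1]

end MonomialIdeals

/-! ### Hilbert functions of the edge ideal and of B -/

lemma hilbertFunction_circulantC16 :
    hilbertFunction (edgeIdeal ℚ circulantC16) 0 = 1 ∧
    hilbertFunction (edgeIdeal ℚ circulantC16) 1 = 16 ∧
    hilbertFunction (edgeIdeal ℚ circulantC16) 2 = 96 ∧
    hilbertFunction (edgeIdeal ℚ circulantC16) 3 = 320 ∧
    hilbertFunction (edgeIdeal ℚ circulantC16) 4 = 768 := by
  obtain ⟨h1, h2, h3, h4⟩ := faceCount_circulant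
  have h (i : ℕ) : hilbertFunction (edgeIdeal ℚ circulantC16) i =
      Nat.card {m : Fin 16 →₀ ℕ // m.degree = i ∧ IsCirculantIndep m.support} := by
    rw [hilbertFunction_eq_card fun g => mem_edgeIdeal_iff]
    congr!
    simp [IsCirculantIndep]
  simp only [h, card_degree_support]
  refine ⟨natCard_degree_zero (by simp [IsCirculantIndep]), ?_⟩
  simp [Finset.sum_range_succ, h1, h2, h3, h4, Nat.choose]

/-- With f_j faces of j elements, the Hilbert function is f_1, f_1 + f_2, f_1 + 2f_2 + f_3 in
degrees 1, 2, 3, so the inequality is `faceCount_extendsIndep` rewritten. -/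
lemma hilbertFunction_colon_circulantC16
    {B : Ideal (MvPolynomial (Fin 16) ℚ)} {T : Finset (Fin 16)}
    (hBT : ∀ g, g ∈ B ↔ ∀ m ∈ g.support, ¬ ExtendsIndep T m.support) {s : Fin 16}
    (hT : T.Nonempty) (hTs : ∀ k ∈ T, circulantC16.Adj s k) :
    hilbertFunction B 0 = 1 ∧
    4 * hilbertFunction B 2 + 6 ≤ hilbertFunction B 3 + 6 * hilbertFunction B 1 := by
  have h (i : ℕ) : hilbertFunction B i =
      Nat.card {m : Fin 16 →₀ ℕ // m.degree = i ∧ ExtendsIndep T m.support} := by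
    rw [hilbertFunction_eq_card hBT]
    simp only [not_not]
  have key := faceCount_extendsIndep hT hTs
  simp only [h, card_degree_support]
  refine ⟨natCard_degree_zero ?_, ?_⟩
  · obtain ⟨k, hk⟩ := hT
    exact ⟨k, hk, by simp [IsCirculantIndep]⟩
  simp [Finset.sum_range_succ, Nat.choose]
  omega

/-! ### Consequences of a basic double link -/

section Link

variable {σ K : Type*} [Field K]

lemma IsBasicDoubleGLink.mem_of_mul_mem {d : ℕ} {f : MvPolynomial σ K}
    {A B C : Ideal (MvPolynomial σ K)} (h : IsBasicDoubleGLink d f B A C) {g : MvPolynomial σ K}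
    (hg : f * g ∈ A) : g ∈ A := by
  rw [← h.colon, Submodule.mem_colon_singleton, smul_eq_mul, mul_comm]
  exact hg

lemma IsBasicDoubleGLink.mem_iff_mul_mem {d : ℕ} {f : MvPolynomial σ K}
    {A B C : Ideal (MvPolynomial σ K)} (h : IsBasicDoubleGLink d f B A C) (g : MvPolynomial σ K) :
    g ∈ B ↔ f * g ∈ C := by
  rw [h.eq]
  constructor
  · intro hg
    exact Ideal.mem_sup_left (Ideal.mul_mem_mul (Ideal.mem_span_singleton_self f) hg)
  · intro hg
    obtain ⟨x, hx, a, ha, hxa⟩ := Submodule.mem_sup.1 hg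
    obtain ⟨b, hb, rfl⟩ := Ideal.mem_span_singleton_mul.1 hx
    have h1 : f * (g - b) ∈ A := by
      rw [mul_sub, ← hxa, add_sub_cancel_left]
      exact ha
    have h2 := B.add_mem (h.le (h.mem_of_mul_mem h1)) hb
    rwa [sub_add_cancel] at h2

/-- Otherwise fB ⊆ A, and cancelling `f` gives B = A, against the height condition. -/
lemma IsBasicDoubleGLink.not_le [Finite σ] {d : ℕ} {f : MvPolynomial σ K}
    {A B C : Ideal (MvPolynomial σ K)} (h : IsBasicDoubleGLink d f B A C) : ¬ C ≤ A := by
  intro hC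
  have hBA : B ≤ A := fun b hb => h.mem_of_mul_mem (hC ((h.mem_iff_mul_mem b).1 hb))
  have h1 := h.height
  rw [le_antisymm hBA h.le] at h1
  have h2 := Ideal.height_ne_top h.proper_A
  exact (ENat.add_one_le_iff h2).1 h1.le |>.false

lemma IsBasicDoubleGLink.exists_X_mem [Finite σ] {d : ℕ} {f : MvPolynomial σ K}
    {A B : Ideal (MvPolynomial σ K)} {G : SimpleGraph σ}
    (h : IsBasicDoubleGLink d f B A (edgeIdeal K G)) (hB : IsMonomialIdeal B) :
    d = 1 ∧ ∃ s, X s ∈ B := by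
  obtain ⟨hd, b, hb1, hbB, hbA⟩ :
      d = 1 ∧ ∃ b, b.IsHomogeneous 1 ∧ b ∈ B ∧ f * b ∉ A := by
    by_contra! hcon
    apply h.not_le
    refine Ideal.span_le.2 ?_
    rintro _ ⟨i, j, hij, rfl⟩
    have hmem : (X i * X j : MvPolynomial σ K) ∈ edgeIdeal K G :=
      Ideal.subset_span ⟨i, j, hij, rfl⟩
    rw [h.eq] at hmem
    obtain ⟨x, hx, a, ha, hxa⟩ := Submodule.mem_sup.1 hmem
    obtain ⟨b, hb, rfl⟩ := Ideal.mem_span_singleton_mul.1 hx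
    have hXX : (X i * X j : MvPolynomial σ K).IsHomogeneous 2 :=
      (isHomogeneous_X K i).mul (isHomogeneous_X K j)
    have hX2 := homogeneousComponent_eq_self hXX
    rw [← hxa, map_add, homogeneousComponent_mul_of_isHomogeneous h.homogeneous_f, hxa] at hX2
    rw [← hX2]
    refine A.add_mem ?_ (homogeneousComponent_mem_ideal h.homogeneous_A ha 2)
    have hbc := homogeneousComponent_mem_ideal h.homogeneous_B hb (2 - d)
    have hd0 := h.degree_pos
    split_ifs with hd
    -- In degree 2 the cofactor of `f` is a linear form of `B` if d = 1, and a constant of the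
    -- proper ideal `B`, hence zero, if d = 2. For d > 2 there is no contribution.
    · obtain rfl | rfl : d = 1 ∨ d = 2 := by omega
      · exact hcon rfl _ (homogeneousComponent_isHomogeneous _ _) hbc
      · rw [Nat.sub_self, homogeneousComponent_zero] at hbc ⊢
        by_cases hc : coeff 0 b = 0
        · rw [hc, map_zero, mul_zero]
          exact A.zero_mem
        · exact absurd (Ideal.eq_top_of_isUnit_mem _ hbc
            ((isUnit_iff_ne_zero.2 hc).map C)) h.proper_B
    · exact A.zero_mem
  refine ⟨hd, ?_⟩
  have hb0 : b ≠ 0 := by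
    rintro rfl
    rw [mul_zero] at hbA
    exact hbA A.zero_mem
  obtain ⟨u, hu⟩ := support_nonempty.2 hb0
  have hu1 := hb1.degree_eq_sum_deg_support hu
  obtain ⟨s, rfl⟩ : u ∈ Set.range fun i => Finsupp.single i 1 := by
    rw [Finsupp.range_single_one]; exact hu1.symm
  exact ⟨s, hB.monomial_mem hbB hu 1⟩

end Link

/-! ### Primes generated by variables -/

section VariablePrimes

variable (σ K : Type*) [Field K]

/-- The ideal is the kernel of the substitution setting the variables of `U` to zero, a map into a
domain. -/
lemma isPrime_span_X_image (U : Set σ) :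
    (Ideal.span (X '' U) : Ideal (MvPolynomial σ K)).IsPrime := by
  classical
  let φ : MvPolynomial σ K →ₐ[K] MvPolynomial σ K := aeval fun i => if i ∈ U then 0 else X i
  have h1 : (Ideal.Quotient.mkₐ K (Ideal.span (X '' U : Set (MvPolynomial σ K)))).comp φ =
      Ideal.Quotient.mkₐ K _ := by
    ext i
    simp only [AlgHom.comp_apply, φ, aeval_X]
    split_ifs with hi
    · rw [map_zero, Eq.comm]
      exact Ideal.Quotient.eq_zero_iff_mem.2 (Ideal.subset_span ⟨i, hi, rfl⟩)
    · rfl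
  have h2 : Ideal.span (X '' U : Set (MvPolynomial σ K)) = RingHom.ker φ := by
    apply le_antisymm
    · rw [Ideal.span_le]
      rintro _ ⟨i, hi, rfl⟩
      simp [RingHom.mem_ker, φ, hi]
    · intro g hg
      rw [RingHom.mem_ker] at hg
      have h3 := DFunLike.congr_fun h1 g
      rw [AlgHom.comp_apply, hg, map_zero] at h3
      exact Ideal.Quotient.eq_zero_iff_mem.1 h3.symm
  rw [h2]
  exact RingHom.ker_isPrime _

lemma isMaximal_span_X : (Ideal.span (X '' Set.univ) : Ideal (MvPolynomial σ K)).IsMaximal := by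
  have h : (Ideal.span (X '' Set.univ) : Ideal (MvPolynomial σ K)) =
      RingHom.ker (constantCoeff : MvPolynomial σ K →+* K) := by
    ext g
    rw [mem_ideal_span_X_image, RingHom.mem_ker, constantCoeff_eq]
    constructor
    · intro h
      by_contra h0
      obtain ⟨i, -, hi⟩ := h 0 (mem_support_iff.2 h0)
      exact hi rfl
    · intro h m hm
      have hm0 : m ≠ 0 := by
        rintro rfl
        exact mem_support_iff.1 hm h
      obtain ⟨i, hi⟩ := Finsupp.ne_iff.1 hm0
      exact ⟨i, trivial, hi⟩
  rw [h]
  exact RingHom.ker_isMaximal_of_surjective _ fun c => ⟨C c, constantCoeff_C _ c⟩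

variable {σ K}

lemma span_X_image_lt {U V : Set σ} (h : U ⊂ V) :
    (Ideal.span (X '' U) : Ideal (MvPolynomial σ K)) < Ideal.span (X '' V) := by
  refine lt_of_le_of_ne (Ideal.span_mono (Set.image_mono h.subset)) fun heq => ?_
  obtain ⟨i, hiV, hiU⟩ := Set.exists_of_ssubset h
  have h1 : (X i : MvPolynomial σ K) ∈ Ideal.span (X '' U) := by
    rw [heq]; exact Ideal.subset_span ⟨i, hiV, rfl⟩
  rw [mem_ideal_span_X_image] at h1
  obtain ⟨j, hj, hj0⟩ := h1 (Finsupp.single i 1) (by simp [mem_support_iff])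
  rw [Finsupp.single_apply_ne_zero] at hj0
  exact hiU (hj0.1 ▸ hj)

lemma MvPolynomial.IsHomogeneous.mem_span_X {l : MvPolynomial σ K} (hl : l.IsHomogeneous 1) :
    l ∈ Ideal.span (X '' Set.univ : Set (MvPolynomial σ K)) := by
  rw [mem_ideal_span_X_image]
  intro m hm
  have hm1 := hl.degree_eq_sum_deg_support hm
  have hm0 : m ≠ 0 := by
    rintro rfl
    simp at hm1
  obtain ⟨i, hi⟩ := Finsupp.ne_iff.1 hm0
  exact ⟨i, trivial, hi⟩

end VariablePrimes

/-! ### Heights in S/A and Cohen-Macaulay depth -/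

section QuotientHeight

variable {S : Type*} [CommRing S] {A I J : Ideal S}

lemma isPrime_map_mk [I.IsPrime] (hI : A ≤ I) : (I.map (Ideal.Quotient.mk A)).IsPrime :=
  Ideal.map_isPrime_of_surjective Ideal.Quotient.mk_surjective (by rwa [Ideal.mk_ker])

lemma mk_mem_map_iff (hI : A ≤ I) {s : S} :
    Ideal.Quotient.mk A s ∈ I.map (Ideal.Quotient.mk A) ↔ s ∈ I := by
  rw [← Ideal.mem_comap, Ideal.comap_map_of_surjective _ Ideal.Quotient.mk_surjective,
    ← RingHom.ker_eq_comap_bot, Ideal.mk_ker, sup_eq_left.2 hI]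

lemma height_map_mk_add_one_le [I.IsPrime] [J.IsPrime] (hI : A ≤ I) (hIJ : I < J) :
    (I.map (Ideal.Quotient.mk A)).height + 1 ≤ (J.map (Ideal.Quotient.mk A)).height := by
  have := isPrime_map_mk hI
  have := isPrime_map_mk (hI.trans hIJ.le)
  apply Ideal.height_add_one_le_of_lt_of_isPrime
  refine lt_of_le_of_ne (Ideal.map_mono hIJ.le) fun h => hIJ.not_ge fun s hs => ?_
  rw [← mk_mem_map_iff hI, h]
  exact Ideal.mem_map_of_mem _ hs

end QuotientHeight

open IsLocalRing in
lemma IsCohenMacaulayLocal.depthGE {R : Type*} [CommRing R] [IsLocalRing R]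
    (h : IsCohenMacaulayLocal R) {t : ℕ} (ht : (t : ℕ∞) ≤ ringKrullDim R) : DepthGE R R t := by
  obtain ⟨-, rs, hrs, hlen⟩ := h
  refine ⟨rs, ?_, ?_, hrs⟩
  · rw [← hlen] at ht
    exact_mod_cast ht
  · intro r hr
    rw [mem_maximalIdeal, mem_nonunits_iff]
    intro hu
    apply hrs.top_ne_smul
    have h1 : Ideal.ofList rs = ⊤ := Ideal.eq_top_of_isUnit_mem _ (Ideal.subset_span hr) hu
    rw [h1, Submodule.top_smul]

/-- If the prime ideal `P` contains the unmixed ideal `A` and has larger height, then some prime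
ideal containing `A` lies strictly below `P`. -/
lemma IsHeightUnmixed.exists_prime_lt {S : Type*} [CommRing S] [IsNoetherianRing S]
    {A P : Ideal S} [P.IsPrime] (hA : IsHeightUnmixed A) (hAP : A ≤ P)
    (hlt : A.height < P.height) : ∃ Q : Ideal S, Q.IsPrime ∧ A ≤ Q ∧ Q < P := by
  obtain ⟨Q, hQ, hQP⟩ := Ideal.exists_minimalPrimes_le hAP
  have hass : A.minimalPrimes ⊆ associatedPrimes S (S ⧸ A) := by
    have := Module.associatedPrimes.minimalPrimes_annihilator_subset_associatedPrimes S (S ⧸ A)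
    rwa [Ideal.annihilator_quotient] at this
  refine ⟨Q, hQ.isPrime, hQ.le, lt_of_le_of_ne hQP ?_⟩
  rintro rfl
  refine hlt.not_ge ?_
  rw [A.height_eq_inf_minimalPrimes]
  exact le_iInf₂ fun J hJ => (hA _ (hass hQ) _ (hass hJ)).le

/-! ### Depth at the irrelevant ideal and differences of Hilbert functions -/

section GradedDepth

variable {σ K : Type} [Field K] [Finite σ] [Infinite K] {A : Ideal (MvPolynomial σ K)}

/-- One can cut down by a regular linear form if the depth at the irrelevant ideal is positive. -/
lemma exists_hilbertFunction_difference {p : Ideal (MvPolynomial σ K ⧸ A)} [p.IsMaximal]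
    (hp : ∀ s, Ideal.Quotient.mk A s ∈ p ↔ s ∈ Ideal.span (X '' Set.univ))
    {J : Ideal (MvPolynomial σ K)} (hAJ : A ≤ J) (hJ : IsHomogeneousIdeal J) {t : ℕ}
    (h : QuotLocDepthGE p J (t + 1)) :
    ∃ J' : Ideal (MvPolynomial σ K), A ≤ J' ∧ IsHomogeneousIdeal J' ∧
      QuotLocDepthGE p J' t ∧
      ∀ i, hilbertFunction J' (i + 1) + hilbertFunction J i = hilbertFunction J (i + 1) := by
  obtain ⟨l, hl, hreg⟩ := exists_linear_form_regular (J := J) (by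
    intro g hg
    by_contra! hX
    obtain ⟨s, hs, hsg⟩ := h.exists_mul_notMem hAJ hg
    apply hsg
    have hle : Ideal.span (X '' Set.univ) ≤ J.colon {g} := by
      rw [Ideal.span_le]
      rintro _ ⟨i, -, rfl⟩
      exact Submodule.mem_colon_singleton.2 (hX i)
    exact Submodule.mem_colon_singleton.1 (hle ((hp s).1 hs)))
  refine ⟨J ⊔ Ideal.span {l}, le_sup_of_le_left hAJ, hJ.sup_span_singleton hl,
    h.sup_span_singleton hAJ ((hp l).2 hl.mem_span_X) hreg, fun i => ?_⟩
  have hcolon : J.colon {l} = J := by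
    ext g
    rw [Submodule.mem_colon_singleton, smul_eq_mul, mul_comm]
    exact ⟨hreg g, J.mul_mem_left l⟩
  have := hilbertFunction_sup_span_singleton hJ hl i
  rwa [hcolon] at this

end GradedDepth

attribute [local instance] MvPolynomial.gradedAlgebra in
lemma isHomogeneousIdeal_edgeIdeal {σ K : Type*} [Field K] (G : SimpleGraph σ) :
    IsHomogeneousIdeal (edgeIdeal K G) := by
  refine Ideal.homogeneous_span _ _ ?_
  rintro _ ⟨i, j, -, rfl⟩
  exact ⟨2, (isHomogeneous_X K i).mul (isHomogeneous_X K j)⟩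

lemma exists_isCirculantIndep (k : Fin 16) : ∃ a b c d, k ∈ ({a, b, c, d} : Finset (Fin 16)) ∧
    ({a, b, c, d} : Finset (Fin 16)).card = 4 ∧
    IsCirculantIndep {a, b, c, d} := by
  -- The pairwise differences are ±2, ±3, ±5, ±6, ±7 modulo 16, avoiding ±1, ±4 and 8.
  refine ⟨k, k + 3, k + 5, k + 10, by simp, ?_, ?_⟩
  · revert k; decide +kernel
  · simp only [IsCirculantIndep, circulantC16_adj]
    revert k; decide +kernel

lemma edgeIdeal_le_span_X {σ K : Type*} [Field K] {G : SimpleGraph σ} {U : Set σ}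
    (hU : ∀ a ∉ U, ∀ b ∉ U, ¬ G.Adj a b) : edgeIdeal K G ≤ Ideal.span (X '' U) := by
  refine Ideal.span_le.2 ?_
  rintro _ ⟨a, b, hab, rfl⟩
  by_cases ha : a ∈ U
  · exact Ideal.mul_mem_right _ _ (Ideal.subset_span ⟨a, ha, rfl⟩)
  · by_cases hb : b ∈ U
    · exact Ideal.mul_mem_left _ _ (Ideal.subset_span ⟨b, hb, rfl⟩)
    · exact absurd hab (hU a ha b hb)

/-- The quotient by `A` has a chain of primes of length `5` below the irrelevant ideal. -/
lemma five_le_height {f : MvPolynomial (Fin 16) ℚ} {A B : Ideal (MvPolynomial (Fin 16) ℚ)}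
    (h : IsBasicDoubleGLink 1 f B A (edgeIdeal ℚ circulantC16)) {k : Fin 16}
    (hk : coeff (Finsupp.single k 1) f ≠ 0) :
    5 ≤ ((Ideal.span (X '' Set.univ) : Ideal (MvPolynomial (Fin 16) ℚ)).map
      (Ideal.Quotient.mk A)).height := by
  obtain ⟨a, b, c, d, hkF, hcard, hF⟩ := exists_isCirculantIndep k
  let P (U : Set (Fin 16)) : Ideal (MvPolynomial (Fin 16) ℚ) := Ideal.span (X '' U)
  have hP (U : Set (Fin 16)) : (P U).IsPrime := isPrime_span_X_image _ _ U
  let U : Set (Fin 16) := ({a, b, c, d} : Finset (Fin 16))ᶜ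
  have hIU : edgeIdeal ℚ circulantC16 ≤ P U := edgeIdeal_le_span_X (by
    intro i hi j hj
    exact hF i (not_not.1 hi) j (not_not.1 hj))
  have hfU : f ∉ P U := by
    intro hf
    rw [mem_ideal_span_X_image] at hf
    obtain ⟨i, hi, hi0⟩ := hf _ (mem_support_iff.2 hk)
    rw [Finsupp.single_apply_ne_zero] at hi0
    exact hi (by rw [hi0.1]; exact hkF)
  -- The prime contains fB, as it contains the edge ideal, but not `f`, because `k` lies outside
  -- `U`.
  have hBU : B ≤ P U := fun g hg =>
    ((hP U).mem_or_mem (hIU ((h.mem_iff_mul_mem g).1 hg))).resolve_left hfU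
  have hlt : A.height < (P U).height := by
    refine lt_of_lt_of_le ?_ (Ideal.height_mono hBU)
    rw [← h.height]
    exact (ENat.add_one_le_iff (Ideal.height_ne_top h.proper_A)).1 le_rfl
  -- One step of the chain lies below `P U`; adjoining the four missing variables one at a time
  -- gives the other four.
  obtain ⟨Q, hQ, hAQ, hQP⟩ := h.unmixed_A.exists_prime_lt (h.le.trans hBU) hlt
  have hstep (V : Set (Fin 16)) (x : Fin 16) (hx : x ∉ V) : P V < P (insert x V) :=
    span_X_image_lt (Set.ssubset_insert hx)
  have hne : a ≠ b ∧ a ≠ c ∧ a ≠ d ∧ b ≠ c ∧ b ≠ d ∧ c ≠ d := by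
    revert hcard
    clear * -
    revert a b c d
    decide +kernel
  obtain ⟨hab, hac, had, hbc, hbd, hcd⟩ := hne
  have hAU : A ≤ P U := h.le.trans hBU
  have h1 := hstep U a (by simp [U])
  have h2 := hstep _ b (show b ∉ insert a U by simp [U, hab.symm])
  have h3 := hstep _ c (show c ∉ insert b (insert a U) by simp [U, hac.symm, hbc.symm])
  have h4 := hstep _ d (show d ∉ insert c (insert b (insert a U)) by
    simp [U, had.symm, hbd.symm, hcd.symm])
  have huniv : insert d (insert c (insert b (insert a U))) = Set.univ := by
    ext i
    simp [U]
    tauto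
  have e0 := height_map_mk_add_one_le hAQ hQP
  have e1 := height_map_mk_add_one_le hAU h1
  have e2 := height_map_mk_add_one_le (hAU.trans h1.le) h2
  have e3 := height_map_mk_add_one_le (hAU.trans (h1.trans h2).le) h3
  have e4 := height_map_mk_add_one_le (hAU.trans (h1.trans (h2.trans h3)).le) h4
  rw [huniv] at e4
  refine le_trans ?_ e4
  grw [← e3, ← e2, ← e1, ← e0]
  norm_num [add_assoc]

lemma IsBasicDoubleGLink.le_link {σ K : Type*} [Field K] {d : ℕ} {f : MvPolynomial σ K}
    {A B C : Ideal (MvPolynomial σ K)} (h : IsBasicDoubleGLink d f B A C) : A ≤ C := by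
  rw [h.eq]; exact le_sup_right

/-- Eliminates the unknown ideal `A`: the hyperplane section by `f` depends only on `C`, since fB ⊆
(f). -/
lemma IsBasicDoubleGLink.sup_span_singleton_eq {σ K : Type*} [Field K] {d : ℕ}
    {f : MvPolynomial σ K} {A B C : Ideal (MvPolynomial σ K)}
    (h : IsBasicDoubleGLink d f B A C) : A ⊔ Ideal.span {f} = C ⊔ Ideal.span {f} := by
  apply le_antisymm (sup_le_sup_right h.le_link _)
  rw [h.eq]
  refine sup_le (sup_le ?_ le_sup_left) le_sup_right
  exact Ideal.mul_le_left.trans le_sup_right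

lemma IsBasicDoubleGLink.colon_eq {σ K : Type*} [Field K] {d : ℕ}
    {f : MvPolynomial σ K} {A B C : Ideal (MvPolynomial σ K)}
    (h : IsBasicDoubleGLink d f B A C) : C.colon {f} = B := by
  ext g
  rw [Submodule.mem_colon_singleton, smul_eq_mul, mul_comm, h.mem_iff_mul_mem]

theorem mainTheorem2 :
    ¬ ∃ (d : ℕ) (f : MvPolynomial (Fin 16) ℚ) (A B : Ideal (MvPolynomial (Fin 16) ℚ)),
      IsMonomialIdeal B ∧ IsBasicDoubleGLink d f B A (edgeIdeal ℚ circulantC16) := by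
  rintro ⟨d, f, A, B, hB, h⟩
  obtain ⟨rfl, s, hs⟩ := h.exists_X_mem hB
  have hf := h.homogeneous_f
  let T : Finset (Fin 16) := {k | coeff (Finsupp.single k 1) f ≠ 0}
  have hTmem : ∀ k, k ∈ T ↔ coeff (Finsupp.single k 1) f ≠ 0 := by simp [T]
  have hBf := mem_iff_of_colon_edgeIdeal hf hB h.mem_iff_mul_mem
  have hBT : ∀ g, g ∈ B ↔ ∀ m ∈ g.support, ¬ ExtendsIndep T m.support := by
    intro g
    rw [hBf]
    simp only [ExtendsIndep, IsCirculantIndep, hTmem]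
    push Not
    rfl
  have hf0 : f ≠ 0 := by
    rintro rfl
    exact h.proper_A ((Ideal.eq_top_iff_one _).2 (h.mem_of_mul_mem (by simp)))
  have hT : T.Nonempty := by
    obtain ⟨u, hu⟩ := support_nonempty.2 hf0
    have hu1 := hf.degree_eq_sum_deg_support hu
    obtain ⟨k, rfl⟩ : u ∈ Set.range fun i => Finsupp.single i 1 := by
      rw [Finsupp.range_single_one]; exact hu1.symm
    exact ⟨k, (hTmem k).2 (mem_support_iff.1 hu)⟩
  have hTs : ∀ k ∈ T, circulantC16.Adj s k := by
    intro k hk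
    obtain ⟨a, ha, b, hb, hab⟩ := (hBf _).1 hs (Finsupp.single s 1)
      (by simp [mem_support_iff]) k ((hTmem k).1 hk)
    rw [Finsupp.support_single _ one_ne_zero] at ha hb
    simp only [Finset.mem_insert, Finset.mem_singleton] at ha hb
    rcases ha with rfl | rfl <;> rcases hb with rfl | rfl
    · exact absurd hab circulantC16.irrefl
    · exact hab.symm
    · exact hab
    · exact absurd hab circulantC16.irrefl
  obtain ⟨hB0, hBh⟩ := hilbertFunction_colon_circulantC16 hBT hT hTs
  obtain ⟨i0, i1, i2, i3, i4⟩ := hilbertFunction_circulantC16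
  let m : Ideal (MvPolynomial (Fin 16) ℚ) := Ideal.span (X '' Set.univ)
  have hm : m.IsMaximal := isMaximal_span_X _ _
  have hAm : A ≤ m := h.le_link.trans (edgeIdeal_le_span_X (by simp))
  have hpp : (m.map (Ideal.Quotient.mk A)).IsMaximal :=
    (Ideal.map_eq_top_or_isMaximal_of_surjective _ Ideal.Quotient.mk_surjective hm).resolve_left
      (isPrime_map_mk hAm).ne_top
  have hp := fun s => mk_mem_map_iff (I := m) hAm (s := s)
  have hheight : 5 ≤ (m.map (Ideal.Quotient.mk A)).height := by
    obtain ⟨k, hk⟩ := hT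
    exact five_le_height h ((hTmem k).1 hk)
  generalize m.map (Ideal.Quotient.mk A) = p at hpp hp hheight
  have hdA : QuotLocDepthGE p A 5 := by
    refine QuotLocDepthGE.self ((h.cohenMacaulay.2 p).depthGE ?_)
    rw [IsLocalization.AtPrime.ringKrullDim_eq_height p]
    exact_mod_cast hheight
  have hJ := h.sup_span_singleton_eq
  -- Passing to A + (f) costs one unit of depth, leaving four for the linear forms below.
  have hd0 := hdA.sup_span_singleton le_rfl ((hp f).2 hf.mem_span_X) fun g => h.mem_of_mul_mem
  have hAJ : A ≤ A ⊔ Ideal.span {f} := le_sup_left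
  have hH := hilbertFunction_sup_span_singleton (isHomogeneousIdeal_edgeIdeal circulantC16) hf
  have hH0 := hilbertFunction_antitone
    (le_sup_left : edgeIdeal ℚ circulantC16 ≤ edgeIdeal ℚ circulantC16 ⊔ Ideal.span {f}) 0
  have hhom := (isHomogeneousIdeal_edgeIdeal (K := ℚ) circulantC16).sup_span_singleton hf
  rw [hJ] at hd0 hAJ
  rw [h.colon_eq] at hH
  obtain ⟨J1, a1, b1, c1, H1⟩ := exists_hilbertFunction_difference hp hAJ hhom hd0
  obtain ⟨J2, a2, b2, c2, H2⟩ := exists_hilbertFunction_difference hp a1 b1 c1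
  obtain ⟨J3, a3, b3, c3, H3⟩ := exists_hilbertFunction_difference hp a2 b2 c2
  -- Unwinding the four differences, the value of `J4` in degree 4 is a_4 - 4a_3 + 6a_2 - 4a_1 +
  -- a_0, with a_i the Hilbert function for I + (f). Here a_1 = 15 and a_0 ≤ 1, so this natural
  -- number would be at most -1.
  obtain ⟨J4, -, -, -, H4⟩ := exists_hilbertFunction_difference hp a3 b3 c3
  have := hH 0
  have := hH 1
  have := hH 2
  have := hH 3
  have := H1 0
  have := H1 1
  have := H1 2
  have := H1 3
  have := H2 1
  have := H2 2
  have := H2 3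
  have := H3 2
  have := H3 3
  have := H4 3
  simp only [Nat.reduceAdd, zero_add] at *
  omega
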